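/- Let $(X,\mathfrak M,\mu)$ be a measure space. A family $\mathfrak B\subset\mathfrak M$ (whose members are called balls) is a ball-basis with hull constant $K$ if: (B1) $0<\mu(B)<\infty$ for every $B\in\mathfrak B$; (B2) any two points $x,y\in X$ lie in a common ball; (B3) for every $E\in\mathfrak M$ and $\varepsilon>0$ there is a finite (possibly empty) or infinite sequence of balls $B_k$ with $\mu\left(E\,\triangle\,\bigcup_k B_k\right)<\varepsilon$; (B4) for every $B\in\mathfrak B$ there is $B^*\in\mathfrak B$ that contains every $A\in\mathfrak B$ with $\mu(A)\le 2\mu(B)$ and $A\cap B\ne\varnothing$, and satisfies $\mu(B^*)\le K\mu(B)$. No doubling condition is imposed. For $0<\gamma<1$, a collection $\mathcal S\subset\mathfrak B$ is $\gamma$-sparse if there are pairwise disjoint measurable sets $E_B\subset B$, $B\in\mathcal S$, with $\mu(E_B)\ge\gamma\mu(B)$. For $1\le r<\infty$ put $$\langle f\rangle_{B,r}=\Big(\frac1{\mu(B)}\int_B|f|^r\,d\mu\Big)^{1/r},\qquad \langle f\rangle^*_{B,r}=\sup_{A\in\mathfrak B,\ A\supset B}\langle f\rangle_{A,r},\qquad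 \mathcal A^*_{\mathcal S,r}f(x)=\sum_{A\in\mathcal S}\langle f\rangle^*_{A,r}\,\mathbf 1_A(x).$$ Theorem. Let $1\le r<\infty$, $K>0$ and $0<\gamma<1$. For every $p$ with $r<p<\infty$ there is a constant $C$ depending only on $p,r,K,\gamma$, and there is a constant $C'$ depending only on $r,K,\gamma$, such that for every measure space with a ball-basis $\mathfrak B$ with hull constant $K$ and every $\gamma$-sparse collection $\mathcal S\subset\mathfrak B$, the operator $\mathcal A^*_{\mathcal S,r}$ maps $L^p(X)$ to $L^p(X)$ with $$\|\mathcal A^*_{\mathcal S,r}f\|_p\le C\,\|f\|_p\qquad (f\in L^p(X)),$$ and satisfies the weak-$L^r$ estimate $$\mu\{x\in X:\ \mathcal A^*_{\mathcal S,r}f(x)>\lambda\}\le C'\,\frac{\|f\|_r^r}{\lambda^r}\qquad (f\in L^r(X),\ \lambda>0).$$ -/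

import Mathlib

open MeasureTheory
open scoped ENNReal NNReal

/-- `ℬ` is a ball-basis of the measure space `(X, μ)` with hull constant `K`. -/
structure IsBallBasis {X : Type*} [MeasurableSpace X] (μ : Measure X) (ℬ : Set (Set X))
    (K : ℝ≥0) : Prop where
  /-- Balls are measurable. -/
  measurableSet : ∀ B ∈ ℬ, MeasurableSet B
  /-- Balls have positive measure. -/
  measure_pos : ∀ B ∈ ℬ, 0 < μ B
  /-- Balls have finite measure. -/
  measure_lt_top : ∀ B ∈ ℬ, μ B < ∞
  /-- Any two points lie in a common ball. -/
  exists_mem_mem : ∀ x y : X, ∃ B ∈ ℬ, x ∈ B ∧ y ∈ B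
  /-- Measurable sets are approximated in measure by countable unions of balls. -/
  exists_approx : ∀ E : Set X, MeasurableSet E → ∀ ε : ℝ≥0∞, 0 < ε →
    ∃ 𝒞 : Set (Set X), 𝒞.Countable ∧ 𝒞 ⊆ ℬ ∧ μ (symmDiff E (⋃₀ 𝒞)) < ε
  /-- Every ball `B` has a hull `H`. -/
  exists_hull : ∀ B ∈ ℬ, ∃ H ∈ ℬ,
    (⋃ A ∈ {A ∈ ℬ | μ A ≤ 2 * μ B ∧ (A ∩ B).Nonempty}, A) ⊆ H ∧ μ H ≤ K * μ B

/-- The collection `S` is `γ`-sparse: every `B ∈ S` has a measurable part `E B` with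
`μ (E B) ≥ γ μ B`, and these parts are pairwise disjoint. -/
def IsSparse {X : Type*} [MeasurableSpace X] (μ : Measure X) (γ : ℝ≥0)
    (S : Set (Set X)) : Prop :=
  ∃ E : Set X → Set X,
    (∀ B ∈ S, MeasurableSet (E B) ∧ E B ⊆ B ∧ γ * μ B ≤ μ (E B)) ∧ S.PairwiseDisjoint E

/-- The average `⟨f⟩_{B,r} = (μ(B)⁻¹ ∫_B |f|^r)^{1/r}`, as an extended nonnegative number. -/
noncomputable def ballAverage {X 𝕜 : Type*} [MeasurableSpace X] [RCLike 𝕜] (μ : Measure X)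
    (r : ℝ) (f : X → 𝕜) (B : Set X) : ℝ≥0∞ :=
  ((∫⁻ x in B, ‖f x‖ₑ ^ r ∂μ) / μ B) ^ (1 / r)

/-- `⟨f⟩*_{B,r}`, the supremum of `⟨f⟩_{A,r}` over the balls `A ∈ ℬ` that contain `B`. -/
noncomputable def ballAverageSup {X 𝕜 : Type*} [MeasurableSpace X] [RCLike 𝕜] (μ : Measure X)
    (ℬ : Set (Set X)) (r : ℝ) (f : X → 𝕜) (B : Set X) : ℝ≥0∞ :=
  ⨆ A ∈ {A ∈ ℬ | B ⊆ A}, ballAverage μ r f A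

/-- The sparse operator of strong type, `∑_{A ∈ S} ⟨f⟩*_{A,r} 𝟙_A`. -/
noncomputable def strongSparse {X 𝕜 : Type*} [MeasurableSpace X] [RCLike 𝕜] (μ : Measure X)
    (ℬ S : Set (Set X)) (r : ℝ) (f : X → 𝕜) (x : X) : ℝ≥0∞ :=
  ∑' A : S, (A : Set X).indicator (fun _ => ballAverageSup μ ℬ r f A) x


/-! The operator is compared with the maximal function `M φ x = sup {⨍_B φ | x ∈ B ∈ ℬ}` of
`φ = |f| ^ r`. A Vitali covering by hulls gives the weak type `(1, 1)` bound for `M`, and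
interpolation with the trivial `L^∞` bound gives the strong type `(s, s)` bound for `s > 1`.
A point of `A` sees every ball containing `A`, so `(⟨f⟩*_{A,r}) ^ r ≤ M φ` on `A`; sparseness then
gives `∑ μ(A) (⟨f⟩*_{A,r}) ^ p ≤ γ⁻¹ ∫ (M φ) ^ (p / r)`. Finally the `L^p` norm of
`u = ∑ c_A 𝟙_A` is bounded by `∑ μ(A) c_A ^ p`: for `p ≤ 1` by subadditivity, and for `p > 1` by
testing against `v = u ^ (p - 1)` and using that `∑ μ(A) (⨍_A v) ^ q ≤ γ⁻¹ ∫ (M v) ^ q`.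

For the weak estimate at height `t`, the balls with `⟨f⟩*_{A,r} > t` lie in `{M φ > t ^ r}`. On the
other ones `M φ` may be replaced by `min (M φ) (t ^ r)`, and the resulting part of the operator is
estimated in `L^{2r}`.

`M φ` need not be measurable, being a supremum over an uncountable family of balls, so its
integrals are lower integrals. -/

theorem self_mul_rpow_sub_one (a : ℝ≥0∞) {s : ℝ} (hs : 1 ≤ s) : a * a ^ (s - 1) = a ^ s := by
  nth_rw 1 [← ENNReal.rpow_one a]
  rw [← ENNReal.rpow_add_of_nonneg _ _ zero_le_one (sub_nonneg.2 hs), add_sub_cancel]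

section LayerCake

variable {Y Z : Type*} [MeasurableSpace Y] [MeasurableSpace Z] {ν : Measure Y} {ρ : Measure Z}

theorem lintegral_Ioi_ofReal_rpow_eq_top (q : ℝ) :
    ∫⁻ t in Set.Ioi (0 : ℝ), ENNReal.ofReal (t ^ q) = ∞ := by
  by_contra hne
  refine not_integrableOn_Ioi_rpow q
    ((lintegral_ofReal_ne_top_iff_integrable (by fun_prop) ?_).1 hne)
  filter_upwards [ae_restrict_mem measurableSet_Ioi] with t ht
  exact Real.rpow_nonneg (le_of_lt ht) q

theorem lintegral_rpow_eq_lintegral_meas_ofReal_lt_mul {g : Z → ℝ≥0∞} (hg : AEMeasurable g ρ)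
    {q : ℝ} (hq : 0 < q) :
    ∫⁻ z, g z ^ q ∂ρ = ENNReal.ofReal q *
      ∫⁻ t in Set.Ioi (0 : ℝ), ρ {z | ENNReal.ofReal t < g z} * ENNReal.ofReal (t ^ (q - 1)) := by
  by_cases htop : ρ {z | g z = ∞} = 0
  · have hfin : ∀ᵐ z ∂ρ, g z ≠ ∞ := by simpa only [ae_iff, not_not] using htop
    have hreal : ∫⁻ z, g z ^ q ∂ρ = ∫⁻ z, ENNReal.ofReal ((g z).toReal ^ q) ∂ρ := by
      refine lintegral_congr_ae ?_
      filter_upwards [hfin] with z hz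
      rw [← ENNReal.ofReal_rpow_of_nonneg ENNReal.toReal_nonneg hq.le, ENNReal.ofReal_toReal hz]
    rw [hreal, lintegral_rpow_eq_lintegral_meas_lt_mul ρ
      (Filter.Eventually.of_forall fun _ => ENNReal.toReal_nonneg) hg.ennreal_toReal hq]
    congr 1
    refine setLIntegral_congr_fun measurableSet_Ioi fun t ht => ?_
    congr 1
    refine measure_congr ?_
    filter_upwards [hfin] with z hz
    exact propext (ENNReal.ofReal_lt_iff_lt_toReal (le_of_lt ht) hz).symm
  · have hlhs : ∫⁻ z, g z ^ q ∂ρ = ∞ :=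
      lintegral_eq_top_of_measure_eq_top_ne_zero (hg.pow_const q)
        (by simpa [hq, hq.not_gt] using htop)
    have hrhs : ∫⁻ t in Set.Ioi (0 : ℝ), ρ {z | ENNReal.ofReal t < g z} *
        ENNReal.ofReal (t ^ (q - 1)) = ∞ := by
      refine top_le_iff.1 ?_
      calc ∞ = ρ {z | g z = ∞} * ∫⁻ t in Set.Ioi (0 : ℝ), ENNReal.ofReal (t ^ (q - 1)) := by
            rw [lintegral_Ioi_ofReal_rpow_eq_top, ENNReal.mul_top htop]
        _ = ∫⁻ t in Set.Ioi (0 : ℝ), ρ {z | g z = ∞} * ENNReal.ofReal (t ^ (q - 1)) :=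
            (lintegral_const_mul _ (by fun_prop)).symm
        _ ≤ _ := by
            gcongr with t z
            intro (hz : g z = ∞)
            exact hz ▸ ENNReal.ofReal_lt_top
    rw [hlhs, hrhs, ENNReal.mul_top (by simpa using hq)]

theorem lintegral_rpow_le_lintegral_meas_ofReal_lt_mul (F : Y → ℝ≥0∞) {q : ℝ} (hq : 0 < q) :
    ∫⁻ y, F y ^ q ∂ν ≤ ENNReal.ofReal q *
      ∫⁻ t in Set.Ioi (0 : ℝ), ν {y | ENNReal.ofReal t < F y} * ENNReal.ofReal (t ^ (q - 1)) := by
  obtain ⟨G, hGmeas, hGF, hG⟩ := exists_measurable_le_lintegral_eq ν fun y => F y ^ q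
  have hroot : ∀ y, G y = (G y ^ q⁻¹) ^ q := fun y => by rw [ENNReal.rpow_inv_rpow hq.ne']
  rw [hG, lintegral_congr hroot,
    lintegral_rpow_eq_lintegral_meas_ofReal_lt_mul (hGmeas.pow_const q⁻¹).aemeasurable hq]
  gcongr with t y
  exact (ENNReal.rpow_inv_le_iff hq).2 (hGF y)

theorem lintegral_rpow_le_of_mul_meas_ofReal_lt_le {F : Y → ℝ≥0∞} {g : Z → ℝ≥0∞}
    (hg : AEMeasurable g ρ) {s : ℝ} (hs : 1 < s)
    (h : ∀ t : ℝ, 0 < t →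
      ENNReal.ofReal t * ν {y | ENNReal.ofReal t < F y} ≤ ρ {z | ENNReal.ofReal t < g z}) :
    ∫⁻ y, F y ^ s ∂ν ≤ ENNReal.ofReal (s / (s - 1)) * ∫⁻ z, g z ^ (s - 1) ∂ρ := by
  have hs1 : 0 < s - 1 := by linarith
  calc ∫⁻ y, F y ^ s ∂ν
      ≤ ENNReal.ofReal s * ∫⁻ t in Set.Ioi (0 : ℝ),
          ν {y | ENNReal.ofReal t < F y} * ENNReal.ofReal (t ^ (s - 1)) :=
        lintegral_rpow_le_lintegral_meas_ofReal_lt_mul F (by linarith)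
    _ ≤ ENNReal.ofReal s * ∫⁻ t in Set.Ioi (0 : ℝ),
          ρ {z | ENNReal.ofReal t < g z} * ENNReal.ofReal (t ^ (s - 1 - 1)) := by
        refine mul_le_mul_right (setLIntegral_mono' measurableSet_Ioi fun t ht => ?_) _
        have ht : 0 < t := ht
        have hpow : t ^ (s - 1) = t * t ^ (s - 1 - 1) := by
          rw [Real.rpow_sub_one ht.ne' (s - 1), mul_div_cancel₀ _ ht.ne']
        rw [hpow, ENNReal.ofReal_mul ht.le, ← mul_assoc, mul_comm (ν _)]
        exact mul_le_mul_left (h t ht) _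
    _ = ENNReal.ofReal (s / (s - 1)) * ∫⁻ z, g z ^ (s - 1) ∂ρ := by
        rw [lintegral_rpow_eq_lintegral_meas_ofReal_lt_mul hg hs1, ← mul_assoc,
          ← ENNReal.ofReal_mul (by positivity), div_mul_cancel₀ _ hs1.ne']

theorem lintegral_min_rpow_le_of_mul_meas_ofReal_lt_le {F : Y → ℝ≥0∞} {a : ℝ≥0∞}
    (h : ∀ t : ℝ, 0 < t → ENNReal.ofReal t * ν {y | ENNReal.ofReal t < F y} ≤ a) (b : ℝ≥0∞)
    {s : ℝ} (hs : 1 < s) :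
    ∫⁻ y, min (F y) b ^ s ∂ν ≤ ENNReal.ofReal (s / (s - 1)) * (a * b ^ (s - 1)) := by
  refine (lintegral_rpow_le_of_mul_meas_ofReal_lt_le (ρ := a • Measure.dirac ()) (g := fun _ => b)
    aemeasurable_const hs fun t ht => ?_).trans_eq (by simp [mul_comm])
  by_cases htb : ENNReal.ofReal t < b
  · simpa [htb] using h t ht
  · simp [htb]

end LayerCake

/-- The (uncentered) maximal function of `φ` with respect to the family `ℬ`. -/
noncomputable def maximalFunction {X : Type*} [MeasurableSpace X] (μ : Measure X)
    (ℬ : Set (Set X)) (φ : X → ℝ≥0∞) (x : X) : ℝ≥0∞ :=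
  ⨆ B ∈ {B ∈ ℬ | x ∈ B}, ⨍⁻ y in B, φ y ∂μ

/-- The bound `s / (s - 1) * 2 ^ s * K` for the `s`-th power of the norm on `L^s` of the maximal
function of a ball-basis with hull constant `K`. -/
noncomputable def maximalConst (s : ℝ) (K : ℝ≥0) : ℝ≥0 :=
  Real.toNNReal (s / (s - 1)) * (2 ^ s * K)

theorem maximalConst_ne_zero {s : ℝ} (hs : 1 < s) {K : ℝ≥0} (hK : K ≠ 0) :
    maximalConst s K ≠ 0 :=
  mul_ne_zero (Real.toNNReal_pos.2 (div_pos (by linarith) (by linarith))).ne'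
    (mul_ne_zero (NNReal.rpow_pos two_pos).ne' hK)

section MaximalFunction

variable {X : Type*} [MeasurableSpace X] {μ : Measure X} {ℬ : Set (Set X)} {φ : X → ℝ≥0∞}

theorem lt_maximalFunction_iff {a : ℝ≥0∞} {x : X} :
    a < maximalFunction μ ℬ φ x ↔ ∃ B ∈ ℬ, x ∈ B ∧ a < ⨍⁻ y in B, φ y ∂μ := by
  simp only [maximalFunction, lt_iSup_iff, Set.mem_sep_iff, exists_prop, and_assoc]

theorem setLAverage_le_maximalFunction {B : Set X} (hB : B ∈ ℬ) {x : X} (hx : x ∈ B) :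
    ⨍⁻ y in B, φ y ∂μ ≤ maximalFunction μ ℬ φ x :=
  le_iSup₂_of_le B ⟨hB, hx⟩ le_rfl

theorem ballAverage_eq_setLAverage_rpow {𝕜 : Type*} [RCLike 𝕜] (r : ℝ) (f : X → 𝕜) (B : Set X) :
    ballAverage μ r f B = (⨍⁻ x in B, ‖f x‖ₑ ^ r ∂μ) ^ (1 / r) := by
  rw [ballAverage, setLAverage_eq]

theorem ballAverageSup_rpow_le_maximalFunction {𝕜 : Type*} [RCLike 𝕜] {f : X → 𝕜} {r : ℝ}
    (hr : 0 < r) {A : Set X} {x : X} (hx : x ∈ A) :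
    ballAverageSup μ ℬ r f A ^ r ≤ maximalFunction μ ℬ (fun y => ‖f y‖ₑ ^ r) x := by
  rw [← ENNReal.le_rpow_inv_iff hr]
  refine iSup₂_le fun B hB => ?_
  rw [ballAverage_eq_setLAverage_rpow, one_div]
  gcongr
  exact setLAverage_le_maximalFunction hB.1 (hB.2 hx)

end MaximalFunction

namespace IsBallBasis

variable {X : Type*} [MeasurableSpace X] {μ : Measure X} {ℬ : Set (Set X)} {K : ℝ≥0}

theorem sigmaFinite (h : IsBallBasis μ ℬ K) : SigmaFinite μ := by
  obtain ⟨𝒞, h𝒞, hsub, hlt⟩ := h.exists_approx Set.univ MeasurableSet.univ 1 one_pos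
  refine Measure.sigmaFinite_of_countable (S := insert (symmDiff Set.univ (⋃₀ 𝒞)) 𝒞)
    (h𝒞.insert _) ?_ ?_
  · rintro B (rfl | hB)
    · exact hlt.trans ENNReal.one_lt_top
    · exact h.measure_lt_top B (hsub hB)
  · rw [Set.sUnion_insert, ← Set.top_eq_univ, top_symmDiff]
    exact Set.compl_union_self _

theorem hullConstant_ne_zero (h : IsBallBasis μ ℬ K) {B : Set X} (hB : B ∈ ℬ) : K ≠ 0 := by
  rintro rfl
  obtain ⟨H, hH, -, hle⟩ := h.exists_hull B hB
  exact (h.measure_pos H hH).not_ge (by simpa using hle)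

theorem countable_of_isSparse (h : IsBallBasis μ ℬ K) {S : Set (Set X)} (hSℬ : S ⊆ ℬ) {γ : ℝ≥0}
    (hγ : 0 < γ) (hS : IsSparse μ γ S) : S.Countable := by
  have := h.sigmaFinite
  obtain ⟨E, hE, hdisj⟩ := hS
  have hcount := Measure.countable_meas_pos_of_disjoint_iUnion (μ := μ)
    (As := fun B : S => E B) (fun B => (hE B B.2).1)
    fun A B hAB => hdisj A.2 B.2 (Subtype.coe_ne_coe.2 hAB)
  have hpos : {B : S | 0 < μ (E B)} = Set.univ := Set.eq_univ_of_forall fun B =>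
    (ENNReal.mul_pos (by simpa using hγ.ne') (h.measure_pos B (hSℬ B.2)).ne').trans_le
      (hE B B.2).2.2
  rwa [hpos, Set.countable_univ_iff, Set.countable_coe_iff] at hcount

theorem exists_pairwiseDisjoint_measure_sUnion_le (h : IsBallBasis μ ℬ K) {t : Set (Set X)}
    (ht : t ⊆ ℬ) {R : ℝ≥0∞} (hR : R ≠ ∞) (htR : ∀ B ∈ t, μ B ≤ R) :
    ∃ u ⊆ t, u.Countable ∧ u.PairwiseDisjoint id ∧ μ (⋃₀ t) ≤ K * ∑' B : u, μ B := by
  choose! H _ hHsub hHle using h.exists_hull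
  obtain ⟨u, hut, hdisj, hcover⟩ := Vitali.exists_disjoint_subfamily_covering_enlargement
    id t (fun B => (μ B).toReal) 2 one_lt_two (fun _ _ => ENNReal.toReal_nonneg) R.toReal
    (fun B hB => ENNReal.toReal_mono hR (htR B hB))
    (fun B hB => nonempty_of_measure_ne_zero (h.measure_pos B (ht hB)).ne')
  have hu : u.Countable :=
    h.countable_of_isSparse (hut.trans ht) one_pos
      ⟨id, fun B hB => ⟨h.measurableSet B (ht (hut hB)), subset_rfl, by simp⟩, hdisj⟩
  have hsub : ⋃₀ t ⊆ ⋃ B ∈ u, H B := by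
    rintro x ⟨A, hA, hxA⟩
    obtain ⟨B, hB, hAB, hle⟩ := hcover A hA
    have hmeas : μ A ≤ 2 * μ B := by
      rw [← ENNReal.toReal_le_toReal (h.measure_lt_top A (ht hA)).ne
        (ENNReal.mul_ne_top ENNReal.ofNat_ne_top (h.measure_lt_top B (ht (hut hB))).ne)]
      simpa using hle
    exact Set.mem_biUnion hB
      (hHsub B (ht (hut hB)) (Set.mem_biUnion ⟨ht hA, hmeas, hAB⟩ hxA))
  refine ⟨u, hut, hu, hdisj, ?_⟩
  calc μ (⋃₀ t) ≤ ∑' B : u, μ (H B) := (measure_mono hsub).trans (measure_biUnion_le μ hu H)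
    _ ≤ ∑' B : u, K * μ B := ENNReal.tsum_le_tsum fun B => hHle B (ht (hut B.2))
    _ = K * ∑' B : u, μ B := ENNReal.tsum_mul_left

theorem mul_measure_lt_maximalFunction_le (h : IsBallBasis μ ℬ K) (φ : X → ℝ≥0∞) (a : ℝ≥0∞) :
    a * μ {x | a < maximalFunction μ ℬ φ x} ≤ K * ∫⁻ x, φ x ∂μ := by
  set t := {B ∈ ℬ | a < ⨍⁻ y in B, φ y ∂μ}
  have hlevel : {x | a < maximalFunction μ ℬ φ x} = ⋃₀ t := by
    ext x
    simp only [Set.mem_ofPred_eq, lt_maximalFunction_iff, Set.mem_sUnion, t]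
    tauto
  have hmul : ∀ B ∈ t, a * μ B ≤ ∫⁻ x in B, φ x ∂μ := fun B hB => by
    rw [← measure_mul_setLAverage φ (h.measure_lt_top B hB.1).ne, mul_comm]
    exact mul_le_mul_right hB.2.le _
  rw [hlevel]
  rcases eq_or_ne a 0 with rfl | ha
  · simp
  rcases t.eq_empty_or_nonempty with ht | ⟨B₀, hB₀⟩
  · simp [ht]
  rcases eq_or_ne (∫⁻ x, φ x ∂μ) ∞ with hφ | hφ
  · simp [hφ, h.hullConstant_ne_zero hB₀.1]
  obtain ⟨u, hut, hu, hdisj, hle⟩ := h.exists_pairwiseDisjoint_measure_sUnion_le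
    (t := t) (Set.sep_subset _ _) (ENNReal.div_ne_top hφ ha) fun B hB => by
      rw [ENNReal.le_div_iff_mul_le (Or.inl ha) (Or.inr hφ), mul_comm]
      exact (hmul B hB).trans (setLIntegral_le_lintegral B φ)
  calc a * μ (⋃₀ t) ≤ a * (K * ∑' B : u, μ B) := by gcongr
    _ = K * ∑' B : u, a * μ B := by rw [ENNReal.tsum_mul_left, mul_left_comm]
    _ ≤ K * ∑' B : u, ∫⁻ x in B, φ x ∂μ := by
        gcongr with B
        exact hmul B (hut B.2)
    _ = K * ∫⁻ x in ⋃ B ∈ u, B, φ x ∂μ := by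
        rw [lintegral_biUnion hu (fun B hB => h.measurableSet B (hut hB).1) hdisj]
    _ ≤ K * ∫⁻ x, φ x ∂μ := by
        gcongr
        exact Measure.restrict_le_self

theorem maximalFunction_le_maximalFunction_indicator_add (h : IsBallBasis μ ℬ K)
    (φ : X → ℝ≥0∞) (a : ℝ≥0∞) (x : X) :
    maximalFunction μ ℬ φ x ≤ maximalFunction μ ℬ ({y | a < φ y}.indicator φ) x + a := by
  refine iSup₂_le fun B ⟨hB, hxB⟩ => ?_
  have hsplit : ∀ y, φ y ≤ {y | a < φ y}.indicator φ y + a := fun y => by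
    by_cases hy : a < φ y
    · simp [hy]
    · simpa [hy] using not_lt.1 hy
  calc ⨍⁻ y in B, φ y ∂μ
      ≤ ⨍⁻ y in B, ({y | a < φ y}.indicator φ y + a) ∂μ := lintegral_mono hsplit
    _ = ⨍⁻ y in B, {y | a < φ y}.indicator φ y ∂μ + ⨍⁻ _y in B, a ∂μ :=
        lintegral_add_right _ measurable_const
    _ ≤ maximalFunction μ ℬ ({y | a < φ y}.indicator φ) x + a := by
        rw [setLAverage_const (h.measure_pos B hB).ne' (h.measure_lt_top B hB).ne]
        gcongr
        exact setLAverage_le_maximalFunction hB hxB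

theorem mul_measure_lt_maximalFunction_le_setLIntegral (h : IsBallBasis μ ℬ K)
    {φ : X → ℝ≥0∞} (hφ : AEMeasurable φ μ) (a : ℝ≥0∞) :
    a * μ {x | a < maximalFunction μ ℬ φ x} ≤ 2 * K * ∫⁻ x in {x | a < 2 * φ x}, φ x ∂μ := by
  set T := {y | a / 2 < φ y}
  have hT : {x | a < 2 * φ x} = T := by
    ext x
    simp only [Set.mem_ofPred_eq, T, ENNReal.div_lt_iff (Or.inl two_ne_zero)
      (Or.inl ENNReal.ofNat_ne_top), mul_comm]
  have hsub : {x | a < maximalFunction μ ℬ φ x} ⊆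
      {x | a / 2 < maximalFunction μ ℬ (T.indicator φ) x} := fun x hx => by
    have := hx.trans_le (h.maximalFunction_le_maximalFunction_indicator_add φ (a / 2) x)
    conv_lhs at this => rw [← ENNReal.add_halves a]
    exact lt_of_add_lt_add_right this
  calc a * μ {x | a < maximalFunction μ ℬ φ x}
      ≤ 2 * (a / 2) * μ {x | a / 2 < maximalFunction μ ℬ (T.indicator φ) x} := by
        rw [ENNReal.mul_div_cancel two_ne_zero ENNReal.ofNat_ne_top]
        gcongr
    _ ≤ 2 * (K * ∫⁻ x, T.indicator φ x ∂μ) := by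
        rw [mul_assoc]
        exact mul_le_mul_right (h.mul_measure_lt_maximalFunction_le _ _) _
    _ = 2 * K * ∫⁻ x in {x | a < 2 * φ x}, φ x ∂μ := by
        rw [hT, lintegral_indicator₀ (nullMeasurableSet_lt aemeasurable_const hφ), mul_assoc]

theorem lintegral_maximalFunction_rpow_le (h : IsBallBasis μ ℬ K) {φ : X → ℝ≥0∞}
    (hφ : AEMeasurable φ μ) {s : ℝ} (hs : 1 < s) :
    ∫⁻ x, maximalFunction μ ℬ φ x ^ s ∂μ ≤ maximalConst s K * ∫⁻ x, φ x ^ s ∂μ := by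
  have hs1 : 0 < s - 1 := by linarith
  have hac : (2 * K : ℝ≥0∞) • μ.withDensity φ ≪ μ :=
    Measure.smul_absolutelyContinuous.trans (withDensity_absolutelyContinuous μ φ)
  refine (lintegral_rpow_le_of_mul_meas_ofReal_lt_le (g := fun x => 2 * φ x)
    ((hφ.const_mul 2).mono_ac hac) hs fun t _ =>
      (h.mul_measure_lt_maximalFunction_le_setLIntegral hφ _).trans
        (mul_le_mul_right (withDensity_apply_le φ _) _)).trans_eq ?_
  have hpow : ∀ x, φ x * (2 * φ x) ^ (s - 1) = 2 ^ (s - 1) * φ x ^ s := fun x => by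
    rw [ENNReal.mul_rpow_of_nonneg _ _ hs1.le, mul_left_comm, self_mul_rpow_sub_one _ hs.le]
  rw [lintegral_smul_measure, lintegral_withDensity_eq_lintegral_mul₀ hφ
    ((hφ.const_mul 2).pow_const _)]
  simp only [Pi.mul_apply, hpow]
  rw [lintegral_const_mul'' _ (hφ.pow_const s), maximalConst, ENNReal.ofReal, smul_eq_mul]
  push_cast [ENNReal.coe_rpow_of_nonneg _ (zero_le_one.trans hs.le)]
  rw [← self_mul_rpow_sub_one 2 hs.le]
  ring

end IsBallBasis

section FiniteSums

variable {ι Y : Type*}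

theorem indicator_const_rpow (A : Set Y) (c : ℝ≥0∞) {p : ℝ} (hp : 0 < p) (y : Y) :
    A.indicator (fun _ => c) y ^ p = A.indicator (fun _ => c ^ p) y := by
  by_cases hy : y ∈ A <;> simp [hy, hp]

variable [MeasurableSpace Y] {ν : Measure Y}

theorem sum_mul_mul_le_rpow_mul_rpow (s : Finset ι) (w f g : ι → ℝ≥0∞) {p q : ℝ}
    (hpq : p.HolderConjugate q) :
    ∑ i ∈ s, w i * (f i * g i) ≤
      (∑ i ∈ s, w i * f i ^ p) ^ (1 / p) * (∑ i ∈ s, w i * g i ^ q) ^ (1 / q) := by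
  have hroot : ∀ {a : ℝ}, 0 < a → ∀ x y : ℝ≥0∞, (x ^ (1 / a) * y) ^ a = x * y ^ a :=
    fun ha x y => by
      rw [ENNReal.mul_rpow_of_nonneg _ _ ha.le, ← ENNReal.rpow_mul, one_div_mul_cancel ha.ne',
        ENNReal.rpow_one]
  have hsplit : ∀ i, w i * (f i * g i) = w i ^ (1 / p) * f i * (w i ^ (1 / q) * g i) := fun i => by
    rw [mul_mul_mul_comm, ← ENNReal.rpow_add_of_nonneg _ _ (one_div_nonneg.2 hpq.nonneg)
      (one_div_nonneg.2 hpq.symm.nonneg), one_div, one_div, hpq.inv_add_inv_eq_one,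
      ENNReal.rpow_one]
  simpa only [hsplit, hroot hpq.pos, hroot hpq.symm.pos] using
    ENNReal.inner_le_Lp_mul_Lq s (fun i => w i ^ (1 / p) * f i) (fun i => w i ^ (1 / q) * g i) hpq

theorem lintegral_sum_indicator_const_mul (T : Finset ι) {A : ι → Set Y}
    (hA : ∀ i ∈ T, MeasurableSet (A i)) (c : ι → ℝ≥0∞) {v : Y → ℝ≥0∞} (hv : AEMeasurable v ν) :
    ∫⁻ y, (∑ i ∈ T, (A i).indicator (fun _ => c i) y) * v y ∂ν =
      ∑ i ∈ T, c i * ∫⁻ y in A i, v y ∂ν := by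
  simp_rw [Finset.sum_mul, ← Set.indicator_mul_left]
  rw [lintegral_finsetSum' _ fun i hi => (hv.const_mul _).indicator (hA i hi)]
  refine Finset.sum_congr rfl fun i hi => ?_
  rw [lintegral_indicator (hA i hi), lintegral_const_mul'' _ hv.restrict]

theorem lintegral_sum_indicator_const (T : Finset ι) {A : ι → Set Y}
    (hA : ∀ i ∈ T, MeasurableSet (A i)) (c : ι → ℝ≥0∞) :
    ∫⁻ y, ∑ i ∈ T, (A i).indicator (fun _ => c i) y ∂ν = ∑ i ∈ T, ν (A i) * c i := by
  simpa [mul_comm] using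
    lintegral_sum_indicator_const_mul (ν := ν) T hA c (v := fun _ => 1) aemeasurable_const

theorem lintegral_sum_indicator_rpow_le_of_le_one (T : Finset ι) {A : ι → Set Y}
    (hA : ∀ i ∈ T, MeasurableSet (A i)) (c : ι → ℝ≥0∞) {p : ℝ} (hp0 : 0 < p) (hp1 : p ≤ 1) :
    ∫⁻ y, (∑ i ∈ T, (A i).indicator (fun _ => c i) y) ^ p ∂ν ≤ ∑ i ∈ T, ν (A i) * c i ^ p := by
  rw [← lintegral_sum_indicator_const T hA]
  gcongr with y
  simp_rw [← indicator_const_rpow _ _ hp0]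
  exact Finset.le_sum_of_subadditive (· ^ p) (by simp [hp0])
    (fun a b => ENNReal.rpow_add_le_add_rpow a b hp0.le hp1) _ _

theorem lintegral_sum_indicator_rpow_ne_top (T : Finset ι) {A : ι → Set Y}
    (hA : ∀ i ∈ T, MeasurableSet (A i)) (c : ι → ℝ≥0∞) {p : ℝ} (hp : 1 ≤ p)
    (hfin : ∑ i ∈ T, ν (A i) * c i ^ p ≠ ∞) :
    ∫⁻ y, (∑ i ∈ T, (A i).indicator (fun _ => c i) y) ^ p ∂ν ≠ ∞ := by
  have hcard : (T.card : ℝ≥0∞) ^ (p - 1) ≠ ∞ :=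
    ENNReal.rpow_ne_top_of_nonneg (by linarith) (ENNReal.natCast_ne_top _)
  refine ne_top_of_le_ne_top (ENNReal.mul_ne_top hcard hfin) ?_
  rw [← lintegral_sum_indicator_const T hA, ← lintegral_const_mul' _ _ hcard]
  gcongr with y
  simp_rw [← indicator_const_rpow _ _ (zero_lt_one.trans_le hp)]
  exact ENNReal.rpow_sum_le_const_mul_sum_rpow _ _ hp

theorem le_rpow_sub_one_mul_of_le_rpow_mul_rpow {p q : ℝ} (hpq : p.HolderConjugate q)
    {I D L : ℝ≥0∞} (hL : L ≠ 0) (hI : D ≠ ∞ → I ≠ ∞)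
    (h : I ≤ D ^ (1 / p) * (L * I) ^ (1 / q)) : I ≤ L ^ (p - 1) * D := by
  have hp1 : 0 < p - 1 := hpq.sub_one_pos
  rcases eq_or_ne D ∞ with rfl | hD
  · rw [ENNReal.mul_top (by simp [hL, hp1.not_gt])]
    exact le_top
  rcases eq_or_ne I 0 with rfl | hI0
  · exact zero_le
  have hmul : I * I ^ (p - 1) ≤ L ^ (p - 1) * D * I ^ (p - 1) :=
    calc I * I ^ (p - 1) = I ^ p := self_mul_rpow_sub_one I hpq.lt.le
      _ ≤ (D ^ (1 / p) * (L * I) ^ (1 / q)) ^ p := ENNReal.rpow_le_rpow h hpq.nonneg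
      _ = D * (L * I) ^ (p - 1) := by
          rw [ENNReal.mul_rpow_of_nonneg _ _ hpq.nonneg, ← ENNReal.rpow_mul, ← ENNReal.rpow_mul,
            one_div_mul_cancel hpq.ne_zero, ENNReal.rpow_one, one_div_mul_eq_div,
            hpq.div_conj_eq_sub_one]
      _ = L ^ (p - 1) * D * I ^ (p - 1) := by
          rw [ENNReal.mul_rpow_of_nonneg _ _ hp1.le]
          ring
  exact (ENNReal.mul_le_mul_iff_left (ENNReal.rpow_pos (pos_iff_ne_zero.2 hI0) (hI hD)).ne'
    (ENNReal.rpow_ne_top_of_nonneg hp1.le (hI hD))).1 hmul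

end FiniteSums

/-- The sum `∑_{A ∈ S} c_A 𝟙_A`: the operator `strongSparse` with its averages replaced by
arbitrary coefficients. -/
noncomputable def sparseSum {X : Type*} (S : Set (Set X)) (c : Set X → ℝ≥0∞) (x : X) : ℝ≥0∞ :=
  ∑' A : S, (A : Set X).indicator (fun _ => c A) x

section SparseSum

variable {X : Type*} {S : Set (Set X)}

theorem sparseSum_congr_of_forall_mem {S' : Set (Set X)} (hS : S' ⊆ S) (c : Set X → ℝ≥0∞) {x : X}
    (hx : ∀ A ∈ S, x ∈ A → A ∈ S') : sparseSum S c x = sparseSum S' c x := by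
  simp only [sparseSum]
  rw [tsum_subtype S fun A => A.indicator (fun _ => c A) x,
    tsum_subtype S' fun A => A.indicator (fun _ => c A) x]
  refine tsum_congr fun A => ?_
  by_cases hA : x ∈ A
  · have hiff : A ∈ S ↔ A ∈ S' := ⟨fun h => hx A h hA, fun h => hS h⟩
    classical simp only [Set.indicator_apply, hiff]
  · simp [Set.indicator, hA]

variable [MeasurableSpace X] {μ : Measure X}

theorem measurable_sparseSum (hS : S.Countable) (hmeas : ∀ A ∈ S, MeasurableSet A)
    (c : Set X → ℝ≥0∞) : Measurable (sparseSum S c) := by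
  have := hS.to_subtype
  exact Measurable.tsum fun A => measurable_const.indicator (hmeas A A.2)

theorem lintegral_sparseSum_rpow_le_of_forall_finset (hS : S.Countable)
    (hmeas : ∀ A ∈ S, MeasurableSet A) (c : Set X → ℝ≥0∞) {p : ℝ} (hp : 0 < p) {a : ℝ≥0∞}
    (h : ∀ T : Finset S,
      ∫⁻ x, (∑ A ∈ T, (A : Set X).indicator (fun _ => c A) x) ^ p ∂μ ≤ a) :
    ∫⁻ x, sparseSum S c x ^ p ∂μ ≤ a := by
  have := hS.to_subtype
  have hsup : ∀ x, sparseSum S c x ^ p =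
      ⨆ T : Finset S, (∑ A ∈ T, (A : Set X).indicator (fun _ => c A) x) ^ p := fun x => by
    rw [sparseSum, ENNReal.tsum_eq_iSup_sum]
    exact (ENNReal.orderIsoRpow p hp).map_iSup _
  rw [lintegral_congr hsup, lintegral_iSup_directed]
  · exact iSup_le h
  · exact fun T => ((Finset.measurable_sum _ fun (A : S) _ =>
      measurable_const.indicator (hmeas A A.2)).pow_const p).aemeasurable
  · exact Monotone.directed_le fun T T' hT x =>
      ENNReal.rpow_le_rpow (Finset.sum_le_sum_of_subset hT) hp.le

end SparseSum

namespace IsSparse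

variable {X : Type*} [MeasurableSpace X] {μ : Measure X} {γ : ℝ≥0} {S : Set (Set X)}

theorem mono (hS : IsSparse μ γ S) {S' : Set (Set X)} (hS' : S' ⊆ S) : IsSparse μ γ S' := by
  obtain ⟨E, hE, hdisj⟩ := hS
  exact ⟨E, fun B hB => hE B (hS' hB), hdisj.subset hS'⟩

theorem tsum_measure_mul_le (hS : IsSparse μ γ S) (hγ : 0 < γ) {c : Set X → ℝ≥0∞} {g : X → ℝ≥0∞}
    (hcg : ∀ A ∈ S, ∀ x ∈ A, c A ≤ g x) :
    ∑' A : S, μ A * c A ≤ (γ⁻¹ : ℝ≥0) * ∫⁻ x, g x ∂μ := by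
  obtain ⟨E, hE, hdisj⟩ := hS
  have hmeasure : ∀ A ∈ S, μ A ≤ (γ⁻¹ : ℝ≥0) * μ (E A) := fun A hA => by
    rw [ENNReal.coe_inv hγ.ne', mul_comm, ← div_eq_mul_inv, ENNReal.le_div_iff_mul_le
      (Or.inl (by simpa using hγ.ne')) (Or.inl ENNReal.coe_ne_top), mul_comm]
    exact (hE A hA).2.2
  have hpart : ∀ A ∈ S, μ (E A) * c A ≤ ∫⁻ x in E A, g x ∂μ := fun A hA => by
    rw [mul_comm, ← setLIntegral_const]
    exact setLIntegral_mono' (hE A hA).1 fun x hx => hcg A hA x ((hE A hA).2.1 hx)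
  refine ENNReal.summable.tsum_le_of_sum_le fun T => ?_
  calc ∑ A ∈ T, μ A * c A ≤ ∑ A ∈ T, (γ⁻¹ : ℝ≥0) * ∫⁻ x in E A, g x ∂μ := by
        refine Finset.sum_le_sum fun A _ => ?_
        calc μ A * c A ≤ (γ⁻¹ : ℝ≥0) * μ (E A) * c A := by
              gcongr
              exact hmeasure A A.2
          _ ≤ (γ⁻¹ : ℝ≥0) * ∫⁻ x in E A, g x ∂μ := by
              rw [mul_assoc]
              gcongr
              exact hpart A A.2
    _ = (γ⁻¹ : ℝ≥0) * ∫⁻ x in ⋃ A ∈ T, E A, g x ∂μ := by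
        rw [← Finset.mul_sum, lintegral_biUnion_finset
          (fun (A : S) _ (B : S) _ hAB => hdisj A.2 B.2 (Subtype.coe_ne_coe.2 hAB))
          fun (A : S) _ => (hE A A.2).1]
    _ ≤ (γ⁻¹ : ℝ≥0) * ∫⁻ x, g x ∂μ := by
        gcongr
        exact Measure.restrict_le_self

end IsSparse

/-- The constant in the estimate of the `L^p` norm of a sparse sum by its coefficients: `1` for
`p ≤ 1`, and for `p > 1` the constant of the duality argument with the conjugate exponent
`p / (p - 1)`. -/
noncomputable def sparseConst (p : ℝ) (K γ : ℝ≥0) : ℝ≥0 :=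
  if p ≤ 1 then 1 else (γ⁻¹ * maximalConst (p / (p - 1)) K) ^ (p - 1)

namespace IsBallBasis

variable {X : Type*} [MeasurableSpace X] {μ : Measure X} {ℬ S : Set (Set X)} {K γ : ℝ≥0}

theorem tsum_measure_mul_rpow_le (h : IsBallBasis μ ℬ K) (hγ : 0 < γ) (hS : IsSparse μ γ S)
    {φ : X → ℝ≥0∞} (hφ : AEMeasurable φ μ) {c : Set X → ℝ≥0∞}
    (hc : ∀ A ∈ S, ∀ x ∈ A, c A ≤ maximalFunction μ ℬ φ x) {s : ℝ} (hs : 1 < s) :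
    ∑' A : S, μ A * c A ^ s ≤ (γ⁻¹ * maximalConst s K : ℝ≥0) * ∫⁻ x, φ x ^ s ∂μ :=
  calc ∑' A : S, μ A * c A ^ s
      ≤ (γ⁻¹ : ℝ≥0) * ∫⁻ x, maximalFunction μ ℬ φ x ^ s ∂μ :=
        hS.tsum_measure_mul_le hγ (c := fun A => c A ^ s) fun A hA x hx =>
          ENNReal.rpow_le_rpow (hc A hA x hx) (zero_le_one.trans hs.le)
    _ ≤ (γ⁻¹ : ℝ≥0) * (maximalConst s K * ∫⁻ x, φ x ^ s ∂μ) := by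
        gcongr
        exact h.lintegral_maximalFunction_rpow_le hφ hs
    _ = (γ⁻¹ * maximalConst s K : ℝ≥0) * ∫⁻ x, φ x ^ s ∂μ := by
        rw [ENNReal.coe_mul, mul_assoc]

theorem lintegral_sum_indicator_rpow_le (h : IsBallBasis μ ℬ K) (hSℬ : S ⊆ ℬ) (hγ : 0 < γ)
    (hS : IsSparse μ γ S) (c : Set X → ℝ≥0∞) {p : ℝ} (hp : 1 < p) (T : Finset S) :
    ∫⁻ x, (∑ A ∈ T, (A : Set X).indicator (fun _ => c A) x) ^ p ∂μ ≤
      ((γ⁻¹ * maximalConst (p / (p - 1)) K : ℝ≥0) : ℝ≥0∞) ^ (p - 1) *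
        ∑ A ∈ T, μ A * c A ^ p := by
  have hpq : p.HolderConjugate (p / (p - 1)) := Real.HolderConjugate.conjExponent hp
  set q := p / (p - 1)
  set L : ℝ≥0 := γ⁻¹ * maximalConst q K
  set u : X → ℝ≥0∞ := fun x => ∑ A ∈ T, (A : Set X).indicator (fun _ => c A) x
  set v : X → ℝ≥0∞ := fun x => u x ^ (p - 1)
  have hmeas : ∀ A ∈ T, MeasurableSet (A : Set X) := fun A _ => h.measurableSet A (hSℬ A.2)
  have hv : AEMeasurable v μ := ((Finset.measurable_sum _ fun A hA =>
    measurable_const.indicator (hmeas A hA)).pow_const _).aemeasurable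
  have huv : ∀ x, u x ^ p = u x * v x := fun x => (self_mul_rpow_sub_one (u x) hp.le).symm
  have hvq : ∀ x, v x ^ q = u x ^ p := fun x => by
    rw [← ENNReal.rpow_mul, hpq.sub_one_mul_conj]
  rcases T.eq_empty_or_nonempty with rfl | ⟨B, -⟩
  · simp [hpq.pos]
  refine le_rpow_sub_one_mul_of_le_rpow_mul_rpow hpq ?_
    (lintegral_sum_indicator_rpow_ne_top T hmeas _ hp.le) ?_
  · exact_mod_cast mul_ne_zero (inv_ne_zero hγ.ne')
      (maximalConst_ne_zero hpq.symm.lt (h.hullConstant_ne_zero (hSℬ B.2)))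
  calc ∫⁻ x, u x ^ p ∂μ = ∑ A ∈ T, c A * ∫⁻ x in (A : Set X), v x ∂μ := by
        simp_rw [huv]
        exact lintegral_sum_indicator_const_mul T hmeas _ hv
    _ = ∑ A ∈ T, μ A * (c A * ⨍⁻ x in (A : Set X), v x ∂μ) :=
        Finset.sum_congr rfl fun A _ => by
          rw [← measure_mul_setLAverage v (h.measure_lt_top A (hSℬ A.2)).ne, mul_left_comm]
    _ ≤ (∑ A ∈ T, μ A * c A ^ p) ^ (1 / p) *
          (∑ A ∈ T, μ A * (⨍⁻ x in (A : Set X), v x ∂μ) ^ q) ^ (1 / q) :=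
        sum_mul_mul_le_rpow_mul_rpow T _ _ _ hpq
    _ ≤ (∑ A ∈ T, μ A * c A ^ p) ^ (1 / p) * (L * ∫⁻ x, u x ^ p ∂μ) ^ (1 / q) := by
        simp_rw [← hvq]
        have : 0 ≤ 1 / q := one_div_nonneg.2 hpq.symm.nonneg
        gcongr
        exact (ENNReal.sum_le_tsum T).trans <| h.tsum_measure_mul_rpow_le hγ hS hv
          (c := fun A => ⨍⁻ x in A, v x ∂μ)
          (fun A hA x hx => setLAverage_le_maximalFunction (hSℬ hA) hx) hpq.symm.lt

theorem lintegral_sparseSum_rpow_le (h : IsBallBasis μ ℬ K) (hSℬ : S ⊆ ℬ) (hγ : 0 < γ)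
    (hS : IsSparse μ γ S) (c : Set X → ℝ≥0∞) {p : ℝ} (hp : 0 < p) :
    ∫⁻ x, sparseSum S c x ^ p ∂μ ≤ sparseConst p K γ * ∑' A : S, μ A * c A ^ p := by
  have hmeas : ∀ A ∈ S, MeasurableSet A := fun A hA => h.measurableSet A (hSℬ hA)
  refine lintegral_sparseSum_rpow_le_of_forall_finset (h.countable_of_isSparse hSℬ hγ hS) hmeas c hp
    fun T => le_trans ?_ (mul_le_mul_right (ENNReal.sum_le_tsum T) _)
  rcases le_or_gt p 1 with hp1 | hp1
  · rw [sparseConst, if_pos hp1, ENNReal.coe_one, one_mul]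
    exact lintegral_sum_indicator_rpow_le_of_le_one T (fun A _ => hmeas A A.2) _ hp hp1
  · rw [sparseConst, if_neg hp1.not_ge, ENNReal.coe_rpow_of_nonneg _ (sub_nonneg.2 hp1.le)]
    exact h.lintegral_sum_indicator_rpow_le hSℬ hγ hS c hp1 T

theorem rpow_mul_measure_lt_sparseSum_le (h : IsBallBasis μ ℬ K) (hSℬ : S ⊆ ℬ) (hγ : 0 < γ)
    (hS : IsSparse μ γ S) (c : Set X → ℝ≥0∞) {p : ℝ} (hp : 0 < p) (t : ℝ≥0∞) :
    t ^ p * μ {x | t < sparseSum S c x} ≤ sparseConst p K γ * ∑' A : S, μ A * c A ^ p := by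
  have hmeas : Measurable (sparseSum S c) := measurable_sparseSum
    (h.countable_of_isSparse hSℬ hγ hS) (fun A hA => h.measurableSet A (hSℬ hA)) c
  calc t ^ p * μ {x | t < sparseSum S c x}
      ≤ t ^ p * μ {x | t ^ p ≤ sparseSum S c x ^ p} := by
        gcongr with x
        intro (hx : t < sparseSum S c x)
        exact ENNReal.rpow_le_rpow hx.le hp.le
    _ ≤ ∫⁻ x, sparseSum S c x ^ p ∂μ :=
        mul_meas_ge_le_lintegral₀ (hmeas.pow_const p).aemeasurable _
    _ ≤ sparseConst p K γ * ∑' A : S, μ A * c A ^ p :=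
        h.lintegral_sparseSum_rpow_le hSℬ hγ hS c hp

theorem tsum_measure_mul_rpow_le_of_le (h : IsBallBasis μ ℬ K) (hγ : 0 < γ)
    (hS : IsSparse μ γ S) {φ : X → ℝ≥0∞} {c : Set X → ℝ≥0∞}
    (hc : ∀ A ∈ S, ∀ x ∈ A, c A ≤ maximalFunction μ ℬ φ x) {b : ℝ≥0∞} (hcb : ∀ A ∈ S, c A ≤ b)
    {s : ℝ} (hs : 1 < s) :
    ∑' A : S, μ A * c A ^ s ≤
      (γ⁻¹ : ℝ≥0) * (ENNReal.ofReal (s / (s - 1)) * (K * (∫⁻ x, φ x ∂μ) * b ^ (s - 1))) :=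
  calc ∑' A : S, μ A * c A ^ s
      ≤ (γ⁻¹ : ℝ≥0) * ∫⁻ x, min (maximalFunction μ ℬ φ x) b ^ s ∂μ :=
        hS.tsum_measure_mul_le hγ (c := fun A => c A ^ s) fun A hA x hx =>
          ENNReal.rpow_le_rpow (le_min (hc A hA x hx) (hcb A hA)) (zero_le_one.trans hs.le)
    _ ≤ (γ⁻¹ : ℝ≥0) *
          (ENNReal.ofReal (s / (s - 1)) * (K * (∫⁻ x, φ x ∂μ) * b ^ (s - 1))) := by
        gcongr
        exact lintegral_min_rpow_le_of_mul_meas_ofReal_lt_le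
          (fun t _ => h.mul_measure_lt_maximalFunction_le φ _) b hs

theorem rpow_mul_measure_lt_sparseSum_le_of_le (h : IsBallBasis μ ℬ K) (hSℬ : S ⊆ ℬ) (hγ : 0 < γ)
    (hS : IsSparse μ γ S) {r : ℝ} (hr : 0 < r) {φ : X → ℝ≥0∞} {c : Set X → ℝ≥0∞}
    (hc : ∀ A ∈ S, ∀ x ∈ A, c A ^ r ≤ maximalFunction μ ℬ φ x) {t : ℝ≥0∞} (ht0 : t ≠ 0)
    (ht : t ≠ ∞) (hct : ∀ A ∈ S, c A ≤ t) :
    t ^ r * μ {x | t < sparseSum S c x} ≤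
      (2 * K * γ⁻¹ * sparseConst (2 * r) K γ : ℝ≥0) * ∫⁻ x, φ x ∂μ := by
  have htr0 : t ^ r ≠ 0 := (ENNReal.rpow_pos (pos_iff_ne_zero.2 ht0) ht).ne'
  have htr : t ^ r ≠ ∞ := ENNReal.rpow_ne_top_of_nonneg hr.le ht
  have hsq : ∀ a : ℝ≥0∞, a ^ (2 * r) = (a ^ r) ^ (2 : ℝ) := fun a => by
    rw [mul_comm, ENNReal.rpow_mul]
  have hcoeff := h.tsum_measure_mul_rpow_le_of_le hγ hS (c := fun A => c A ^ r) hc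
    (fun A hA => ENNReal.rpow_le_rpow (hct A hA) hr.le) one_lt_two
  simp_rw [← hsq] at hcoeff
  refine (ENNReal.mul_le_mul_iff_left htr0 htr).1 ?_
  calc t ^ r * μ {x | t < sparseSum S c x} * t ^ r
      = t ^ (2 * r) * μ {x | t < sparseSum S c x} := by
        rw [hsq, ENNReal.rpow_two]
        ring
    _ ≤ sparseConst (2 * r) K γ * ∑' A : S, μ A * c A ^ (2 * r) :=
        h.rpow_mul_measure_lt_sparseSum_le hSℬ hγ hS c (by positivity) t
    _ ≤ sparseConst (2 * r) K γ * ((γ⁻¹ : ℝ≥0) * (ENNReal.ofReal (2 / (2 - 1)) *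
          (K * (∫⁻ x, φ x ∂μ) * (t ^ r) ^ (2 - 1 : ℝ)))) := by
        gcongr
    _ = (2 * K * γ⁻¹ * sparseConst (2 * r) K γ : ℝ≥0) * (∫⁻ x, φ x ∂μ) * t ^ r := by
        norm_num
        ring

end IsBallBasis

theorem eLpNorm_ofReal_rpow {X ε : Type*} [MeasurableSpace X] [ENorm ε] (μ : Measure X) (f : X → ε)
    {p : ℝ} (hp : 0 < p) : eLpNorm f (ENNReal.ofReal p) μ ^ p = ∫⁻ x, ‖f x‖ₑ ^ p ∂μ := by
  have := eLpNorm_nnreal_pow_eq_lintegral (f := f) (μ := μ) (Real.toNNReal_pos.2 hp).ne'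
  rwa [Real.coe_toNNReal p hp.le] at this

namespace IsBallBasis

variable {X 𝕜 : Type*} [MeasurableSpace X] [RCLike 𝕜] {μ : Measure X} {ℬ S : Set (Set X)}
  {K γ : ℝ≥0}

theorem measurable_strongSparse (h : IsBallBasis μ ℬ K) (hSℬ : S ⊆ ℬ) (hγ : 0 < γ)
    (hS : IsSparse μ γ S) (r : ℝ) (f : X → 𝕜) : Measurable (strongSparse μ ℬ S r f) :=
  measurable_sparseSum (h.countable_of_isSparse hSℬ hγ hS)
    (fun A hA => h.measurableSet A (hSℬ hA)) _

theorem lintegral_strongSparse_rpow_le (h : IsBallBasis μ ℬ K) (hSℬ : S ⊆ ℬ) (hγ : 0 < γ)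
    (hS : IsSparse μ γ S) {r p : ℝ} (hr : 0 < r) (hrp : r < p) {f : X → 𝕜}
    (hf : AEStronglyMeasurable f μ) :
    ∫⁻ x, strongSparse μ ℬ S r f x ^ p ∂μ ≤
      (sparseConst p K γ * (γ⁻¹ * maximalConst (p / r) K) : ℝ≥0) * ∫⁻ x, ‖f x‖ₑ ^ p ∂μ := by
  have hpow : ∀ a : ℝ≥0∞, (a ^ r) ^ (p / r) = a ^ p := fun a => by
    rw [← ENNReal.rpow_mul, mul_div_cancel₀ _ hr.ne']
  have hcoeff := h.tsum_measure_mul_rpow_le hγ hS (hf.enorm.pow_const r)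
    (c := fun A => ballAverageSup μ ℬ r f A ^ r)
    (fun A _ x hx => ballAverageSup_rpow_le_maximalFunction hr hx) ((one_lt_div hr).2 hrp)
  simp only [hpow] at hcoeff
  rw [ENNReal.coe_mul, mul_assoc]
  exact (h.lintegral_sparseSum_rpow_le hSℬ hγ hS _ (hr.trans hrp)).trans
    (mul_le_mul_right hcoeff _)

theorem eLpNorm_strongSparse_le (h : IsBallBasis μ ℬ K) (hSℬ : S ⊆ ℬ) (hγ : 0 < γ)
    (hS : IsSparse μ γ S) {r p : ℝ} (hr : 0 < r) (hrp : r < p) {f : X → 𝕜}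
    (hf : AEStronglyMeasurable f μ) :
    eLpNorm (strongSparse μ ℬ S r f) (ENNReal.ofReal p) μ ≤
      ((sparseConst p K γ * (γ⁻¹ * maximalConst (p / r) K)) ^ p⁻¹ : ℝ≥0) *
        eLpNorm f (ENNReal.ofReal p) μ := by
  have hp : 0 < p := hr.trans hrp
  rw [← ENNReal.rpow_le_rpow_iff hp, ENNReal.mul_rpow_of_nonneg _ _ hp.le,
    eLpNorm_ofReal_rpow μ _ hp, eLpNorm_ofReal_rpow μ _ hp, ← ENNReal.coe_rpow_of_nonneg _ hp.le,
    NNReal.rpow_inv_rpow hp.ne']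
  exact h.lintegral_strongSparse_rpow_le hSℬ hγ hS hr hrp hf

theorem measure_lt_strongSparse_le (h : IsBallBasis μ ℬ K) (hSℬ : S ⊆ ℬ) (hγ : 0 < γ)
    (hS : IsSparse μ γ S) {r : ℝ} (hr : 0 < r) (f : X → 𝕜) {t : ℝ≥0∞} (ht0 : t ≠ 0)
    (ht : t ≠ ∞) :
    t ^ r * μ {x | t < strongSparse μ ℬ S r f x} ≤
      (K + 2 * K * γ⁻¹ * sparseConst (2 * r) K γ : ℝ≥0) * ∫⁻ x, ‖f x‖ₑ ^ r ∂μ := by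
  set c := ballAverageSup μ ℬ r f
  set φ : X → ℝ≥0∞ := fun x => ‖f x‖ₑ ^ r
  set S' := {A ∈ S | c A ≤ t}
  have hS' : S' ⊆ S := Set.sep_subset _ _
  have hc : ∀ A ∈ S, ∀ x ∈ A, c A ^ r ≤ maximalFunction μ ℬ φ x := fun A _ x hx =>
    ballAverageSup_rpow_le_maximalFunction hr hx
  have hsub : {x | t < strongSparse μ ℬ S r f x} ⊆
      {x | t ^ r < maximalFunction μ ℬ φ x} ∪ {x | t < sparseSum S' c x} := fun x hx => by
    by_contra! hx'
    simp only [Set.mem_union, Set.mem_ofPred_eq, not_or, not_lt] at hx'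
    have heq : sparseSum S c x = sparseSum S' c x :=
      sparseSum_congr_of_forall_mem hS' c fun A hA hxA =>
        ⟨hA, (ENNReal.rpow_le_rpow_iff hr).1 ((hc A hA x hxA).trans hx'.1)⟩
    exact (hx'.2.trans_lt hx).ne heq.symm
  calc t ^ r * μ {x | t < strongSparse μ ℬ S r f x}
      ≤ t ^ r * (μ {x | t ^ r < maximalFunction μ ℬ φ x} + μ {x | t < sparseSum S' c x}) := by
        gcongr
        exact (measure_mono hsub).trans (measure_union_le _ _)
    _ ≤ K * ∫⁻ x, φ x ∂μ + (2 * K * γ⁻¹ * sparseConst (2 * r) K γ : ℝ≥0) * ∫⁻ x, φ x ∂μ := by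
        rw [mul_add]
        exact add_le_add (h.mul_measure_lt_maximalFunction_le φ _)
          (h.rpow_mul_measure_lt_sparseSum_le_of_le (hS'.trans hSℬ) hγ (hS.mono hS') hr
            (fun A hA => hc A (hS' hA)) ht0 ht fun A hA => hA.2)
    _ = (K + 2 * K * γ⁻¹ * sparseConst (2 * r) K γ : ℝ≥0) * ∫⁻ x, φ x ∂μ := by
        rw [ENNReal.coe_add, add_mul]

end IsBallBasis

theorem theorem1_general (r : ℝ) (hr : 0 < r) (K γ : ℝ≥0) (hγ : 0 < γ) :
    (∀ p : ℝ, r < p → ∃ C : ℝ≥0, ∀ (X : Type*) [MeasurableSpace X] (μ : Measure X)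
        (ℬ S : Set (Set X)), IsBallBasis μ ℬ K → S ⊆ ℬ → IsSparse μ γ S →
        ∀ (𝕜 : Type*) [RCLike 𝕜] (f : X → 𝕜), MemLp f (ENNReal.ofReal p) μ →
          MemLp (strongSparse μ ℬ S r f) (ENNReal.ofReal p) μ ∧
          eLpNorm (strongSparse μ ℬ S r f) (ENNReal.ofReal p) μ
            ≤ C * eLpNorm f (ENNReal.ofReal p) μ) ∧
    (∃ C : ℝ≥0, ∀ (X : Type*) [MeasurableSpace X] (μ : Measure X)
        (ℬ S : Set (Set X)), IsBallBasis μ ℬ K → S ⊆ ℬ → IsSparse μ γ S →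
        ∀ (𝕜 : Type*) [RCLike 𝕜] (f : X → 𝕜) (t : ℝ), 0 < t →
          μ {x | ENNReal.ofReal t < strongSparse μ ℬ S r f x}
            ≤ C * eLpNorm f (ENNReal.ofReal r) μ ^ r / ENNReal.ofReal t ^ r) := by
  refine ⟨fun p hrp => ⟨(sparseConst p K γ * (γ⁻¹ * maximalConst (p / r) K)) ^ p⁻¹,
      fun X _ μ ℬ S h hSℬ hS 𝕜 _ f hf => ?_⟩,
    K + 2 * K * γ⁻¹ * sparseConst (2 * r) K γ, fun X _ μ ℬ S h hSℬ hS 𝕜 _ f t ht => ?_⟩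
  · have hle := h.eLpNorm_strongSparse_le hSℬ hγ hS hr hrp hf.1
    exact ⟨⟨(h.measurable_strongSparse hSℬ hγ hS r f).aestronglyMeasurable,
      hle.trans_lt (ENNReal.mul_lt_top ENNReal.coe_lt_top hf.2)⟩, hle⟩
  · have ht0 : ENNReal.ofReal t ≠ 0 := (ENNReal.ofReal_pos.2 ht).ne'
    rw [ENNReal.le_div_iff_mul_le
      (Or.inl (ENNReal.rpow_pos (ENNReal.ofReal_pos.2 ht) ENNReal.ofReal_ne_top).ne')
      (Or.inl (ENNReal.rpow_ne_top_of_nonneg hr.le ENNReal.ofReal_ne_top)), mul_comm,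
      eLpNorm_ofReal_rpow μ f hr]
    exact h.measure_lt_strongSparse_le hSℬ hγ hS hr f ht0 ENNReal.ofReal_ne_top

theorem theorem1 (r : ℝ) (hr : 1 ≤ r) (K γ : ℝ≥0) (hγ0 : 0 < γ) (hγ1 : γ < 1) :
    (∀ p : ℝ, r < p → ∃ C : ℝ≥0, ∀ (X : Type*) [MeasurableSpace X] (μ : Measure X)
        (ℬ S : Set (Set X)), IsBallBasis μ ℬ K → S ⊆ ℬ → IsSparse μ γ S →
        ∀ (𝕜 : Type*) [RCLike 𝕜] (f : X → 𝕜), MemLp f (ENNReal.ofReal p) μ →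
          MemLp (strongSparse μ ℬ S r f) (ENNReal.ofReal p) μ ∧
          eLpNorm (strongSparse μ ℬ S r f) (ENNReal.ofReal p) μ
            ≤ C * eLpNorm f (ENNReal.ofReal p) μ) ∧
    (∃ C : ℝ≥0, ∀ (X : Type*) [MeasurableSpace X] (μ : Measure X)
        (ℬ S : Set (Set X)), IsBallBasis μ ℬ K → S ⊆ ℬ → IsSparse μ γ S →
        ∀ (𝕜 : Type*) [RCLike 𝕜] (f : X → 𝕜), MemLp f (ENNReal.ofReal r) μ →
          ∀ t : ℝ, 0 < t →
            μ {x | ENNReal.ofReal t < strongSparse μ ℬ S r f x}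
              ≤ C * eLpNorm f (ENNReal.ofReal r) μ ^ r / ENNReal.ofReal t ^ r) := by
  obtain ⟨hstrong, C, hweak⟩ := theorem1_general r (by linarith) K γ hγ0
  exact ⟨hstrong, C, fun X _ μ ℬ S h hSℬ hS 𝕜 _ f _ => hweak X μ ℬ S h hSℬ hS 𝕜 f⟩
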